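/- An upfamily on a set $X$ is a family $\mathcal F$ of non-empty subsets of $X$ such that $A\in\mathcal F$ and $A\subset B\subset X$ imply $B\in\mathcal F$; it is linked if $A\cap B\neq\emptyset$ for all $A,B\in\mathcal F$. The superextension $\lambda(X)$ is the set of all linked upfamilies on $X$ that are maximal, with respect to inclusion, among the linked upfamilies on $X$. For a family $\mathcal B$ of subsets of $X$ put $\langle\mathcal B\rangle=\{A\subset X:\exists B\in\mathcal B\ (B\subset A)\}$. If $S$ is a semigroup, then $\lambda(S)$ is a semigroup under $$\mathcal A*\mathcal B=\Big\langle\bigcup_{a\in A}aB_a : A\in\mathcal A,\ \{B_a\}_{a\in A}\subset\mathcal B\Big\rangle .$$ For $n\ge 1$ let $C_n=\{z\in\mathbb C: z^n=1\}$ be the multiplicative cyclic group of order $n$, and let $\mathrm{Aut}(S)$ denote the automorphism group of a semigroup (or group) $S$. **Theorem.** The semigroup $\lambda(C_5)$ has exactly $81$ elements, and $$\mathrm{Aut}(\lambda(C_5))\cong\mathrm{Aut}(C_5)\cong C_4 .$$ More precisely, assigning to $\varphi\in\mathrm{Aut}(C_5)$ the map $\lambda\varphi:\mathcal M\mapsto\langle\varphi(M):M\in\mathcal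 M\rangle$ defines a group isomorphism from $\mathrm{Aut}(C_5)$ onto $\mathrm{Aut}(\lambda(C_5))$; in particular, every automorphism of the semigroup $\lambda(C_5)$ is induced by a unique automorphism of the group $C_5$. -/

import Mathlib

namespace Superext

/-- An upfamily on `X`: a family of non-empty subsets of `X` that is closed under taking
supersets. -/
def IsUpfamily {X : Type*} (F : Set (Set X)) : Prop :=
  (∀ A ∈ F, A.Nonempty) ∧ ∀ A ∈ F, ∀ B : Set X, A ⊆ B → B ∈ F

/-- A family of sets is linked if any two of its members intersect. -/
def IsLinked {X : Type*} (F : Set (Set X)) : Prop :=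
  ∀ A ∈ F, ∀ B ∈ F, (A ∩ B).Nonempty

/-- The family `⟨F⟩` of all supersets of members of `F`. -/
def upClosure {X : Type*} (F : Set (Set X)) : Set (Set X) :=
  {A | ∃ B ∈ F, B ⊆ A}

/-- A maximal linked upfamily: a maximal element, with respect to inclusion, of the set of all
linked upfamilies on `X`. -/
def IsMaximalLinked {X : Type*} (F : Set (Set X)) : Prop :=
  Maximal (fun H : Set (Set X) => IsUpfamily H ∧ IsLinked H) F

/-- The product of two families of subsets of `S`: the family generated by the sets
`⋃ a ∈ A, a * B a` with `A ∈ F` and `B a ∈ H` for all `a ∈ A`. -/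
def familyMul {S : Type*} [Mul S] (F H : Set (Set S)) : Set (Set S) :=
  upClosure {C | ∃ A ∈ F, ∃ B : S → Set S, (∀ a ∈ A, B a ∈ H) ∧
    C = ⋃ a ∈ A, (fun x => a * x) '' B a}

/-- The image of a family under a map: the family generated by the sets `f '' M`, `M ∈ F`. -/
def familyMap {X Y : Type*} (f : X → Y) (F : Set (Set X)) : Set (Set Y) :=
  upClosure {C | ∃ M ∈ F, C = f '' M}

theorem IsMaximalLinked.mem_or_compl_mem {X : Type*} [Nonempty X] {F : Set (Set X)}
    (hF : IsMaximalLinked F) (A : Set X) : A ∈ F ∨ Aᶜ ∈ F := by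
  have key : ∀ A : Set X, A.Nonempty → A ∈ F ∨ Aᶜ ∈ F := by
    intro A hA
    by_cases h : ∃ B ∈ F, ¬ (A ∩ B).Nonempty
    · obtain ⟨B, hB, hAB⟩ := h
      refine Or.inr (hF.prop.1.2 B hB _ fun x hx hxA => hAB ⟨x, hxA, hx⟩)
    · push Not at h
      refine Or.inl ?_
      have hle : F ≤ F ∪ {C | A ⊆ C} := Set.subset_union_left
      refine hF.le_of_ge ⟨⟨?_, ?_⟩, ?_⟩ hle (Or.inr (Set.Subset.refl A))
      · rintro C (hC | hC)
        · exact hF.prop.1.1 C hC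
        · exact hA.mono hC
      · rintro C (hC | hC) D hCD
        · exact Or.inl (hF.prop.1.2 C hC D hCD)
        · exact Or.inr (Set.Subset.trans hC hCD)
      · rintro C (hC | hC) D (hD | hD)
        · exact hF.prop.2 C hC D hD
        · obtain ⟨x, hx, hx'⟩ := h C hC
          exact ⟨x, hx', hD hx⟩
        · obtain ⟨x, hx, hx'⟩ := h D hD
          exact ⟨x, hC hx, hx'⟩
        · obtain ⟨x, hx⟩ := hA
          exact ⟨x, hC hx, hD hx⟩
  rcases A.eq_empty_or_nonempty with rfl | hA
  · have := key Set.univ Set.univ_nonempty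
    simpa [or_comm] using this
  · exact key A hA

theorem IsMaximalLinked.of_mem_or_compl_mem {X : Type*} {F : Set (Set X)}
    (hU : IsUpfamily F) (hL : IsLinked F)
    (h : ∀ A : Set X, A.Nonempty → A ∈ F ∨ Aᶜ ∈ F) : IsMaximalLinked F := by
  refine ⟨⟨hU, hL⟩, fun H hH hFH A hA => ?_⟩
  rcases h A (hH.1.1 A hA) with h1 | h1
  · exact h1
  · obtain ⟨x, hx, hx'⟩ := hH.2 A hA _ (hFH h1)
    exact absurd hx hx'

theorem mem_familyMul {S : Type*} [Mul S] {F H : Set (Set S)} (hF : IsUpfamily F)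
    (hH : IsUpfamily H) (C : Set S) :
    C ∈ familyMul F H ↔ {x | {y | x * y ∈ C} ∈ H} ∈ F := by
  constructor
  · rintro ⟨_, ⟨A, hA, B, hB, rfl⟩, hC⟩
    refine hF.2 A hA _ fun a ha => hH.2 (B a) (hB a ha) _ fun y hy => hC ?_
    exact Set.mem_biUnion ha ⟨y, hy, rfl⟩
  · intro h
    refine ⟨_, ⟨_, h, fun x => {y | x * y ∈ C}, fun a ha => ha, rfl⟩, ?_⟩
    intro z hz
    simp only [Set.mem_iUnion] at hz
    obtain ⟨a, _, y, hy, rfl⟩ := hz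
    exact hy

theorem mem_familyMap {X Y : Type*} (f : X → Y) {F : Set (Set X)} (hF : IsUpfamily F)
    (C : Set Y) : C ∈ familyMap f F ↔ f ⁻¹' C ∈ F := by
  constructor
  · rintro ⟨_, ⟨M, hM, rfl⟩, hC⟩
    exact hF.2 M hM _ (Set.image_subset_iff.1 hC)
  · intro h
    exact ⟨_, ⟨_, h, rfl⟩, Set.image_preimage_subset f C⟩

theorem IsMaximalLinked.familyMul {S : Type*} [Mul S] {F H : Set (Set S)}
    (hF : IsMaximalLinked F) (hH : IsMaximalLinked H) :
    IsMaximalLinked (Superext.familyMul F H) := by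
  have hmem := mem_familyMul hF.prop.1 hH.prop.1
  have hlink : IsLinked (Superext.familyMul F H) := by
    intro C hC D hD
    rw [hmem] at hC hD
    obtain ⟨x, hx, hx'⟩ := hF.prop.2 _ hC _ hD
    obtain ⟨y, hy, hy'⟩ := hH.prop.2 _ hx _ hx'
    exact ⟨x * y, hy, hy'⟩
  refine .of_mem_or_compl_mem ⟨fun C hC => (hlink C hC C hC).mono Set.inter_subset_left, ?_⟩
    hlink ?_
  · rintro C ⟨D, hD, hDC⟩ E hCE
    exact ⟨D, hD, Set.Subset.trans hDC hCE⟩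
  · rintro C ⟨c, _⟩
    have : Nonempty S := ⟨c⟩
    rw [hmem, hmem]
    refine (hF.mem_or_compl_mem _).imp id fun h => hF.prop.1.2 _ h _ fun x hx => ?_
    exact (hH.mem_or_compl_mem {y | x * y ∈ C}).resolve_left hx

theorem IsMaximalLinked.familyMap {X Y : Type*} (f : X → Y) {F : Set (Set X)}
    (hF : IsMaximalLinked F) (hne : Nonempty X ∨ IsEmpty Y) :
    IsMaximalLinked (Superext.familyMap f F) := by
  have hmem := mem_familyMap f hF.prop.1
  have hlink : IsLinked (Superext.familyMap f F) := by
    intro C hC D hD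
    rw [hmem] at hC hD
    obtain ⟨x, hx, hx'⟩ := hF.prop.2 _ hC _ hD
    exact ⟨f x, hx, hx'⟩
  refine .of_mem_or_compl_mem ⟨fun C hC => (hlink C hC C hC).mono Set.inter_subset_left, ?_⟩
    hlink ?_
  · rintro C ⟨D, hD, hDC⟩ E hCE
    exact ⟨D, hD, Set.Subset.trans hDC hCE⟩
  · rintro C ⟨c, _⟩
    have : Nonempty X := hne.resolve_right fun h => h.false c
    rw [hmem, hmem]
    exact hF.mem_or_compl_mem _

end Superext

/-- The superextension `λ(X)`: the set of all maximal linked upfamilies on `X`. -/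
def Superextension (X : Type*) : Type _ :=
  {F : Set (Set X) // Superext.IsMaximalLinked F}

namespace Superextension

/-- The semigroup structure on the superextension of a semigroup. -/
instance {S : Type*} [Semigroup S] : Semigroup (Superextension S) where
  mul L M := ⟨Superext.familyMul L.1 M.1, L.2.familyMul M.2⟩
  mul_assoc L M N := by
    apply Subtype.ext
    ext C
    change C ∈ Superext.familyMul (Superext.familyMul L.1 M.1) N.1 ↔
      C ∈ Superext.familyMul L.1 (Superext.familyMul M.1 N.1)
    rw [Superext.mem_familyMul (L.2.familyMul M.2).prop.1 N.2.prop.1,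
      Superext.mem_familyMul L.2.prop.1 M.2.prop.1,
      Superext.mem_familyMul L.2.prop.1 (M.2.familyMul N.2).prop.1]
    simp only [Superext.mem_familyMul M.2.prop.1 N.2.prop.1, Set.mem_ofPred_eq, mul_assoc]

/-- The map `λ(X) → λ(Y)` induced by a map `f : X → Y`, for non-empty `X`. -/
def map {X Y : Type*} [Nonempty X] (f : X → Y) (L : Superextension X) : Superextension Y :=
  ⟨Superext.familyMap f L.1, L.2.familyMap f (Or.inl inferInstance)⟩

end Superextension

/-- The cyclic group `C_n`, as the multiplicative group of complex `n`-th roots of unity. -/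
abbrev RootGroup (n : ℕ) : Type := rootsOfUnity n ℂ

/-! Index the points by ℤ/5, the subsets by 5-bit numbers and a family by the 32-bit number of its
members; the product becomes `codeMul`. A maximal linked family containing a singleton is principal.
Otherwise it is determined by its pairs, since complementation settles the larger sets, and these
form an arbitrary family of pairwise intersecting pairs, that is, an independent set of the Petersen
graph. This gives 5 + 76 = 81.

Principal ultrafilters are exactly the invertible elements, so an automorphism `Ψ` of λ(C₅) permutes
them by some `φ` in Aut(C₅). Dividing by the automorphism induced by `φ` reduces surjectivity to
rigidity (`codes_rigid`): an automorphism fixing every principal ultrafilter is trivial. Write z for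
the majority family (sets of at least 3 points), and e, f, a, b for the non-principal families with
pairs {0,1},{0,4}; {0,2},{0,3}; {0,1}; {0,2}. Here z is the only translation-invariant element, and
e, f are the only two of the three remaining idempotents with product z. Multiplication tables
exclude the swap of e and f and then fix a and b. A non-principal c is determined by (ce, cf), whose
entries are z or translates of e, a and of f, b, so c is fixed. -/

namespace Superextension

/-! ### Coding families on five points by numbers. -/

/-- The set of those points of `G` whose index under `ι` is a binary digit of `n`. -/
def bitSet {G : Type*} (ι : Fin 5 ≃ G) (n : ℕ) : Set G :=
  {g | n.testBit (ι.symm g)}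

open Classical in
/-- The binary digits of the code of a family record which of the 32 subsets belong to it. -/
noncomputable def code {G : Type*} (ι : Fin 5 ≃ G) (L : Superextension G) : ℕ :=
  Nat.ofBits fun n : Fin 32 => decide (bitSet ι n ∈ L.1)

/-- The product of families in terms of their codes. -/
def codeMul (c d : ℕ) : ℕ :=
  Nat.ofBits fun n : Fin 32 => c.testBit <| Nat.ofBits fun x : Fin 5 => d.testBit <|
    Nat.ofBits fun y : Fin 5 => (n : ℕ).testBit (x + y : Fin 5)

/-- The codes of the maximal linked upfamilies on a set of five points. -/
def codes : List ℕ :=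
  [
   2863311530, 3435973836, 4042322160, 4278255360, 4294901760, 4276676736, 4008241288,
   4209567904, 3941132456, 4243122368, 3974686920, 4176013536, 3907578088, 4272482944,
   4004047496, 4205374112, 3936938664, 4274580608, 4006145160, 4241026240, 3972590792,
   4270386816, 4001951368, 4276156544, 4209047712, 4242602176, 4175493344, 4271962752,
   4204853920, 4274060416, 4240506048, 4269866624, 4276791424, 4008355976, 4209682592,
   3941247144, 4272597632, 4004162184, 4205488800, 3937053352, 4276930688, 4008495240,
   4243376320, 3974940872, 4274834560, 4006399112, 4241280192, 3972844744, 4277045376,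
   4008609928, 4277723264, 4210614432, 4244168896, 4177060064, 4277203072, 4210094240,
   4243648704, 4176539872, 4277837952, 4210729120, 4277977216, 4244422848, 4278091904,
   4293453824, 4289260032, 4291357696, 4287163904, 4292933632, 4288739840, 4290837504,
   4286643712, 4293568512, 4289374720, 4293707776, 4291611648, 4293822464, 4294500352,
   4293980160, 4294615040, 4294754304, 4294868992]

end Superextension

namespace Superextension

section Code

variable {G : Type*} (ι : Fin 5 ≃ G)

theorem exists_bitSet_eq (A : Set G) : ∃ n < 32, bitSet ι n = A := by
  classical
  refine ⟨Nat.ofBits fun i : Fin 5 => decide (ι i ∈ A), Nat.ofBits_lt_two_pow _, ?_⟩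
  ext g
  simp [bitSet]

theorem bitSet_ofBits (p : Fin 5 → Bool) : bitSet ι (Nat.ofBits p) = {g | p (ι.symm g)} := by
  ext g
  simp [bitSet]

theorem testBit_code (L : Superextension G) {n : ℕ} (hn : n < 32) :
    (code ι L).testBit n = true ↔ bitSet ι n ∈ L.1 := by
  simp [code, Nat.testBit_ofBits_lt _ _ hn]

theorem code_injective : Function.Injective (code ι) := by
  intro L M h
  apply Subtype.ext
  ext A
  obtain ⟨n, hn, rfl⟩ := exists_bitSet_eq ι A
  rw [← testBit_code ι L hn, ← testBit_code ι M hn, h]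

theorem code_mul [CommGroup G] (hι : ∀ x y, ι (x + y) = ι x * ι y) (L M : Superextension G) :
    code ι (L * M) = codeMul (code ι L) (code ι M) := by
  classical
  rw [code, codeMul]
  congr 1
  funext n
  rw [Bool.eq_iff_iff, decide_eq_true_iff, testBit_code ι _ (Nat.ofBits_lt_two_pow _),
    bitSet_ofBits]
  refine (Superext.mem_familyMul L.2.prop.1 M.2.prop.1 _).trans (iff_of_eq (congrArg (· ∈ L.1) ?_))
  ext g
  simp only [Set.mem_ofPred_eq]
  rw [testBit_code ι _ (Nat.ofBits_lt_two_pow _), bitSet_ofBits]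
  refine iff_of_eq (congrArg (· ∈ M.1) ?_)
  ext h
  obtain ⟨x, rfl⟩ := ι.surjective g
  obtain ⟨y, rfl⟩ := ι.surjective h
  simp [bitSet, ← hι]

end Code

/-! ### Enumeration of the maximal linked families. -/

section Codes

set_option maxRecDepth 100000

/-- The variables are the ten pairs, the hypotheses the fifteen disjointness relations between them.
In the vector, singletons are absent, and a triple is present exactly when its complementary pair is
not. -/
theorem ofBits_mem_codes_of_pairs : ∀ p3 p5 p6 p9 p10 p12 p17 p18 p20 p24 : Bool,
    (p6 && p9) = false → (p5 && p10) = false → (p3 && p12) = false → (p6 && p17) = false →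
    (p10 && p17) = false → (p12 && p17) = false → (p5 && p18) = false → (p9 && p18) =
    false → (p12 && p18) = false → (p3 && p20) = false → (p9 && p20) = false → (p10 &&
    p20) = false → (p3 && p24) = false → (p5 && p24) = false → (p6 && p24) = false →
    Nat.ofBits
      ![false, false, false, p3, false, p5, p6, !p24, false, p9, p10, !p20, p12, !p18,
      !p17, true, false, p17, p18, !p12, p20, !p10, !p9, true, p24, !p6, !p5, true, !p3,
      true, true, true] ∈ codes := by
  decide +kernel

theorem ofBits_testBit_mem_codes : ∀ i : Fin 5,
    (Nat.ofBits fun n : Fin 32 => (n : ℕ).testBit i) ∈ codes := by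
  decide +kernel

theorem and_eq_of_testBit_le : ∀ n m : Fin 32,
    (∀ i : Fin 5, (n : ℕ).testBit i → (m : ℕ).testBit i) → (n : ℕ) &&& m = n := by
  decide +kernel

theorem testBit_compl : ∀ n : Fin 32, ∀ i : Fin 5,
    ((31 - n : Fin 32) : ℕ).testBit i = !(n : ℕ).testBit i := by
  decide +kernel

theorem and_two_pow_eq : ∀ n : Fin 32, ∀ i : Fin 5, (n : ℕ).testBit i →
    ((⟨2 ^ (i : ℕ), Nat.pow_lt_pow_right one_lt_two i.isLt⟩ : Fin 32) : ℕ) &&& n = 2 ^ (i : ℕ) := by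
  decide +kernel

theorem ofBits_mem_codes (b : Fin 32 → Bool) (h0 : b 0 = false)
    (hmono : ∀ n m : Fin 32, (n : ℕ) &&& m = n → b n → b m)
    (hc : ∀ n, b (31 - n) = !b n)
    (hl : ∀ n m : Fin 32, (n : ℕ) &&& m = 0 → (b n && b m) = false) :
    Nat.ofBits b ∈ codes := by
  by_cases hs : ∃ i : Fin 5, b ⟨2 ^ (i : ℕ), Nat.pow_lt_pow_right one_lt_two i.isLt⟩ = true
  · obtain ⟨i, hi⟩ := hs
    have key : ∀ n : Fin 32, (n : ℕ).testBit i → b n := fun n hn =>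
      hmono _ n (and_two_pow_eq n i hn) hi
    -- A set avoiding `i` has a complement containing `i`, hence in the family.
    have : b = fun n : Fin 32 => (n : ℕ).testBit i := by
      funext n
      rcases h : (n : ℕ).testBit i with _ | _
      · have := key (31 - n) (by rw [testBit_compl, h]; rfl)
        simpa [hc] using this
      · exact key n h
    rw [this]
    exact ofBits_testBit_mem_codes i
  · simp only [not_exists, Bool.not_eq_true] at hs
    have := ofBits_mem_codes_of_pairs (b 3) (b 5) (b 6) (b 9) (b 10) (b 12) (b 17) (b 18) (b 20) (b 24)
      (hl 6 9 rfl) (hl 5 10 rfl) (hl 3 12 rfl) (hl 6 17 rfl) (hl 10 17 rfl) (hl 12 17 rfl) (hl 5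
      18 rfl) (hl 9 18 rfl) (hl 12 18 rfl) (hl 3 20 rfl) (hl 9 20 rfl) (hl 10 20 rfl) (hl 3 24
      rfl) (hl 5 24 rfl) (hl 6 24 rfl)
    convert this using 2
    funext n
    fin_cases n
    all_goals first
      | rfl
      | exact h0
      | exact hs 0
      | exact hs 1
      | exact hs 2
      | exact hs 3
      | exact hs 4
      | exact (hc 0).trans (congrArg _ h0)
      | exact (hc 1).trans (congrArg _ (hs 0))
      | exact (hc 2).trans (congrArg _ (hs 1))
      | exact (hc 4).trans (congrArg _ (hs 2))
      | exact (hc 8).trans (congrArg _ (hs 3))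
      | exact (hc 16).trans (congrArg _ (hs 4))
      | exact hc 3
      | exact hc 5
      | exact hc 6
      | exact hc 9
      | exact hc 10
      | exact hc 12
      | exact hc 17
      | exact hc 18
      | exact hc 20
      | exact hc 24

theorem testBit_mono_of_mem_codes : ∀ c ∈ codes, ∀ n m : Fin 32,
    (n : ℕ) &&& m = n → c.testBit n → c.testBit m := by
  decide +kernel

theorem and_ne_zero_of_mem_codes : ∀ c ∈ codes, ∀ n m : Fin 32,
    c.testBit n → c.testBit m → (n : ℕ) &&& m ≠ 0 := by
  decide +kernel

theorem testBit_or_compl_of_mem_codes : ∀ c ∈ codes, ∀ n : Fin 32,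
    c.testBit n ∨ c.testBit (31 - n : Fin 32) := by
  decide +kernel

theorem lt_of_mem_codes : ∀ c ∈ codes, c < 2 ^ 32 := by
  decide +kernel

theorem codes_nodup : codes.Nodup := by
  decide +kernel

end Codes

/-! ### The codes correspond bijectively to λ(G). -/

section Code

variable {G : Type*} (ι : Fin 5 ≃ G)

theorem bitSet_compl (n : Fin 32) : bitSet ι (31 - n : Fin 32) = (bitSet ι n)ᶜ := by
  ext g
  simp [bitSet, testBit_compl]

theorem and_eq_of_bitSet_subset {n m : Fin 32} (h : bitSet ι n ⊆ bitSet ι m) :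
    (n : ℕ) &&& m = n :=
  and_eq_of_testBit_le n m fun i hi => by
    simpa [bitSet] using h (show ι i ∈ bitSet ι n by simpa [bitSet] using hi)

theorem bitSet_inter (n m : ℕ) : bitSet ι n ∩ bitSet ι m = bitSet ι (n &&& m) := by
  ext g
  simp [bitSet]

theorem bitSet_zero : bitSet ι 0 = ∅ := by
  ext g
  simp [bitSet]

theorem bitSet_mono {n m : ℕ} (h : n &&& m = n) : bitSet ι n ⊆ bitSet ι m := by
  rw [← h, ← bitSet_inter]
  exact Set.inter_subset_right

theorem code_mem_codes (L : Superextension G) : code ι L ∈ codes := by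
  classical
  have : Nonempty G := ⟨ι 0⟩
  have hne : ∀ A ∈ L.1, ∀ B ∈ L.1, A ∩ B ≠ ∅ := fun A hA B hB => (L.2.prop.2 A hA B hB).ne_empty
  apply ofBits_mem_codes
  · have : ∅ ∉ L.1 := fun h => hne _ h _ h (Set.inter_empty _)
    simpa [bitSet_zero] using this
  · intro n m h
    simpa using fun hn => L.2.prop.1.2 _ hn _ (bitSet_mono ι h)
  · intro n
    rw [bitSet_compl, Bool.eq_iff_iff]
    simp only [decide_eq_true_eq, Bool.not_eq_true', decide_eq_false_iff_not]
    exact ⟨fun h h' => hne _ h' _ h (Set.inter_compl_self _),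
      (L.2.mem_or_compl_mem _).resolve_left⟩
  · intro n m h
    have : bitSet ι n ∩ bitSet ι m = ∅ := by rw [bitSet_inter, h, bitSet_zero]
    simpa using fun hn hm => hne _ hn _ hm this

theorem exists_code_eq {c : ℕ} (hc : c ∈ codes) : ∃ L : Superextension G, code ι L = c := by
  have hmem : ∀ n : Fin 32, bitSet ι n ∈ {A | ∃ m : Fin 32, bitSet ι m = A ∧ c.testBit m} ↔
      c.testBit n := by
    refine fun n => ⟨?_, fun h => ⟨n, rfl, h⟩⟩
    rintro ⟨m, hm, h⟩
    exact testBit_mono_of_mem_codes c hc m n (and_eq_of_bitSet_subset ι hm.subset) h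
  have hlink : Superext.IsLinked {A | ∃ m : Fin 32, bitSet ι m = A ∧ c.testBit m} := by
    rintro _ ⟨n, rfl, hn⟩ _ ⟨m, rfl, hm⟩
    rw [Set.nonempty_iff_ne_empty, ← bitSet_zero ι, bitSet_inter]
    intro h
    refine and_ne_zero_of_mem_codes c hc n m hn hm ?_
    have h32 : (n : ℕ) &&& m < 32 := Nat.and_lt_two_pow (n := 5) _ m.isLt
    have := and_eq_of_bitSet_subset ι (n := ⟨_, h32⟩) (m := 0) h.subset
    simpa using this.symm
  have hex : ∀ A : Set G, ∃ n : Fin 32, bitSet ι n = A := fun A =>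
    let ⟨n, hn, h⟩ := exists_bitSet_eq ι A
    ⟨⟨n, hn⟩, h⟩
  have hmax : Superext.IsMaximalLinked {A | ∃ m : Fin 32, bitSet ι m = A ∧ c.testBit m} := by
    refine .of_mem_or_compl_mem ⟨fun A hA => ?_, ?_⟩ hlink ?_
    · have := hlink A hA A hA
      rwa [Set.inter_self] at this
    · rintro _ ⟨n, rfl, hn⟩ B hB
      obtain ⟨m, rfl⟩ := hex B
      exact ⟨m, rfl, testBit_mono_of_mem_codes c hc n m (and_eq_of_bitSet_subset ι hB) hn⟩
    · intro A _
      obtain ⟨n, rfl⟩ := hex A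
      rw [← bitSet_compl, hmem, hmem]
      exact testBit_or_compl_of_mem_codes c hc n
  obtain ⟨L, hL⟩ : ∃ L : Superextension G,
      L.1 = {A | ∃ m : Fin 32, bitSet ι m = A ∧ c.testBit m} := ⟨⟨_, hmax⟩, rfl⟩
  refine ⟨L, Nat.eq_of_testBit_eq fun i => ?_⟩
  rcases lt_or_ge i 32 with hi | hi
  · rw [Bool.eq_iff_iff, testBit_code ι _ hi, hL]
    exact hmem ⟨i, hi⟩
  -- Bits from 32 on encode no subset and must vanish on both sides.
  · rw [code, Nat.testBit_ofBits_ge _ i hi, Nat.testBit_eq_false_of_lt]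
    exact (lt_of_mem_codes c hc).trans_le (Nat.pow_le_pow_right two_pos hi)

end Code

theorem card_eq_of_equiv_fin_five {G : Type*} (ι : Fin 5 ≃ G) : Nat.card (Superextension G) = 81 := by
  classical
  have e : Superextension G ≃ codes.toFinset :=
    Equiv.ofBijective (fun L => ⟨code ι L, List.mem_toFinset.2 (code_mem_codes ι L)⟩)
      ⟨fun L M h => code_injective ι (congrArg Subtype.val h), fun ⟨c, hc⟩ =>
        let ⟨L, hL⟩ := exists_code_eq ι (List.mem_toFinset.1 hc)
        ⟨L, Subtype.ext hL⟩⟩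
  rw [Nat.card_congr e, Nat.card_eq_fintype_card, Fintype.card_coe,
    List.toFinset_card_of_nodup codes_nodup]
  rfl

end Superextension

/-! ### Rigidity of the multiplication table. -/

namespace Superextension
section Rigidity
set_option maxRecDepth 100000

/-- 3435973836 is the principal ultrafilter at the generator 1 and 4276676736 is z. This
characterises z by data that `ψ` preserves. -/
theorem codes_eq_zero_of_translate_eq : ∀ c ∈ codes,
    codeMul 3435973836 c = c → c = 4276676736 := by
  decide +kernel

/-- In order: the identity, z, e, f, and the family whose pairs are all four pairs through 0. -/
theorem codes_idempotent : ∀ c ∈ codes, codeMul c c = c →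
    c ∈ [2863311530, 4276676736, 4008355976, 4205374112, 3937053352] := by
  decide +kernel

theorem codes_orthogonal_idempotents :
    ∀ c ∈ [4008355976, 4205374112, 3937053352], ∀ d ∈ [4008355976, 4205374112, 3937053352],
    codeMul c d = 4276676736 →
    (c = 4008355976 ∧ d = 4205374112) ∨ (c = 4205374112 ∧ d = 4008355976) := by
  decide +kernel

/-- If ce is a given translate of e, few values remain for cf. Intersecting such lists over several
c pins down the image of a or b. -/
theorem codes_mul_right_of_mul_left : ∀ c ∈ codes,
    (codeMul c 4008355976 = 4008355976 → codeMul c 4205374112 ∈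
      [4276676736, 4209567904, 4272482944, 4205374112, 4276930688]) ∧
    (codeMul c 4008355976 = codeMul 3435973836 4008355976 → codeMul c 4205374112 ∈
      [4276676736, 4209567904, 4274580608, 4276930688, 4274834560]) ∧
    (codeMul c 4008355976 = codeMul 4042322160 4008355976 → codeMul c 4205374112 ∈
      [4276676736, 4209567904, 4274580608, 4277723264, 4210614432]) ∧
    (codeMul c 4008355976 = codeMul 4278255360 4008355976 → codeMul c 4205374112 ∈
      [4276676736, 4272482944, 4274580608, 4270386816, 4277723264]) := by
  decide +kernel

theorem codes_mul_left_of_mul_right : ∀ c ∈ codes,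
    (codeMul c 4205374112 = 4205374112 → codeMul c 4008355976 ∈
      [4276676736, 4008241288, 4276156544, 4276791424, 4008355976]) ∧
    (codeMul c 4205374112 = codeMul 3435973836 4205374112 → codeMul c 4008355976 ∈
      [4276676736, 4008241288, 4243122368, 3974686920, 4293453824]) := by
  decide +kernel

theorem codes_mul_mem : ∀ c ∈ codes.drop 5,
    codeMul c 4008355976 ∈ 4276676736 ::
      ((codes.take 5).map (codeMul · 4008355976) ++ (codes.take 5).map (codeMul · 4008241288)) ∧
    codeMul c 4205374112 ∈ 4276676736 ::
      ((codes.take 5).map (codeMul · 4205374112) ++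
        (codes.take 5).map (codeMul · 4209567904)) := by
  decide +kernel

theorem codes_pair_injective : ∀ c ∈ codes.drop 5, ∀ d ∈ codes.drop 5,
    codeMul c 4008355976 = codeMul d 4008355976 →
    codeMul c 4205374112 = codeMul d 4205374112 → c = d := by
  decide +kernel

/-- An injective endomorphism of the codes that fixes the codes of the principal ultrafilters
fixes every code. -/
theorem codes_rigid (ψ : ℕ → ℕ) (hmem : ∀ c ∈ codes, ψ c ∈ codes)
    (hmul : ∀ c ∈ codes, ∀ d ∈ codes, ψ (codeMul c d) = codeMul (ψ c) (ψ d))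
    (hinj : ∀ c ∈ codes, ∀ d ∈ codes, ψ c = ψ d → c = d)
    (hfix : ∀ c ∈ codes.take 5, ψ c = c) : ∀ c ∈ codes, ψ c = c := by
  have hM : ∀ c ∈ codes, ∀ d ∈ codes, ∀ x, codeMul c d = x → codeMul (ψ c) (ψ d) = ψ x :=
    fun c hc d hd x hx => hx ▸ (hmul c hc d hd).symm
  have m0 : 2863311530 ∈ codes := by decide +kernel
  have m1 : 3435973836 ∈ codes := by decide +kernel
  have m2 : 4042322160 ∈ codes := by decide +kernel
  have m3 : 4278255360 ∈ codes := by decide +kernel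
  have mz : 4276676736 ∈ codes := by decide +kernel
  have me : 4008355976 ∈ codes := by decide +kernel
  have mf : 4205374112 ∈ codes := by decide +kernel
  have ma : 4008241288 ∈ codes := by decide +kernel
  have mb : 4209567904 ∈ codes := by decide +kernel
  have f0 := hfix 2863311530 (by decide +kernel)
  have f1 := hfix 3435973836 (by decide +kernel)
  have f2 := hfix 4042322160 (by decide +kernel)
  have f3 := hfix 4278255360 (by decide +kernel)
  have fz : ψ 4276676736 = 4276676736 := by
    apply codes_eq_zero_of_translate_eq _ (hmem _ mz)
    have := hM _ m1 _ mz _ (by decide +kernel : _ = 4276676736)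
    rwa [f1] at this
  have hidem : ∀ c ∈ codes, codeMul c c = c → c ≠ 2863311530 → c ≠ 4276676736 →
      ψ c ∈ [4008355976, 4205374112, 3937053352] := by
    intro c hc h h0 hz
    have := codes_idempotent _ (hmem c hc) (hM c hc c hc c h)
    rw [List.mem_cons, List.mem_cons] at this
    rcases this with h' | h' | h'
    · exact absurd (hinj _ hc _ m0 (h'.trans f0.symm)) h0
    · exact absurd (hinj _ hc _ mz (h'.trans fz.symm)) hz
    · exact h'
  have hψe := hidem 4008355976 me (by decide +kernel) (by norm_num) (by norm_num)
  have hψf := hidem 4205374112 mf (by decide +kernel) (by norm_num) (by norm_num)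
  have hef := hM _ me _ mf _ (by decide +kernel : _ = 4276676736)
  rw [fz] at hef
  -- Each yᵢ satisfies yᵢe = a, while yᵢf is the translate of f by i.
  have my0 : 3936938664 ∈ codes := by decide +kernel
  have my1 : 4006399112 ∈ codes := by decide +kernel
  have my3 : 4001951368 ∈ codes := by decide +kernel
  have y0e := hM _ my0 _ me _ (by decide +kernel : _ = 4008241288)
  have y1e := hM _ my1 _ me _ (by decide +kernel : _ = 4008241288)
  have y3e := hM _ my3 _ me _ (by decide +kernel : _ = 4008241288)
  have y0f := hM _ my0 _ mf _ (by decide +kernel : _ = 4205374112)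
  have y1f := hM _ my1 _ mf _ (by decide +kernel : _ = codeMul 3435973836 4205374112)
  have y3f := hM _ my3 _ mf _ (by decide +kernel : _ = codeMul 4278255360 4205374112)
  rw [hmul _ m1 _ mf, f1] at y1f
  rw [hmul _ m3 _ mf, f3] at y3f
  rcases codes_orthogonal_idempotents _ hψe _ hψf hef with ⟨fe, ff⟩ | ⟨fe, ff⟩
  · rw [fe] at y0e y1e
    rw [ff] at y0f y1f
    have fa : ψ 4008241288 = 4008241288 := by
      have h0 := (codes_mul_left_of_mul_right _ (hmem _ my0)).1 y0f
      have h1 := (codes_mul_left_of_mul_right _ (hmem _ my1)).2 y1f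
      rw [y0e] at h0
      rw [y1e] at h1
      -- z and a are the only entries common to the two lists.
      have h : ψ 4008241288 = 4276676736 ∨ ψ 4008241288 = 4008241288 := by
        revert h0 h1
        generalize ψ 4008241288 = w
        revert w
        simp +contextual
      exact h.resolve_left fun h => by simpa using hinj _ ma _ mz (h.trans fz.symm)
    -- The mirror device for b: wᵢf = b, while wᵢe is the translate of e by i.
    have mw0 : 3941247144 ∈ codes := by decide +kernel
    have mw2 : 4175493344 ∈ codes := by decide +kernel
    have w0e := hM _ mw0 _ me _ (by decide +kernel : _ = 4008355976)
    have w2e := hM _ mw2 _ me _ (by decide +kernel : _ = codeMul 4042322160 4008355976)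
    have w0f := hM _ mw0 _ mf _ (by decide +kernel : _ = 4209567904)
    have w2f := hM _ mw2 _ mf _ (by decide +kernel : _ = 4209567904)
    rw [hmul _ m2 _ me, f2] at w2e
    rw [fe] at w0e w2e
    rw [ff] at w0f w2f
    have fb : ψ 4209567904 = 4209567904 := by
      have h0 := (codes_mul_right_of_mul_left _ (hmem _ mw0)).1 w0e
      have h2 := (codes_mul_right_of_mul_left _ (hmem _ mw2)).2.2.1 w2e
      rw [w0f] at h0
      rw [w2f] at h2
      have h : ψ 4209567904 = 4276676736 ∨ ψ 4209567904 = 4209567904 := by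
        revert h0 h2
        generalize ψ 4209567904 = w
        revert w
        simp +contextual
      exact h.resolve_left fun h => by simpa using hinj _ mb _ mz (h.trans fz.symm)
    have htrans : ∀ x ∈ codes, ψ x = x → ∀ y ∈ (codes.take 5).map (codeMul · x), ψ y = y := by
      intro x hx hψx y hy
      obtain ⟨g, hg, rfl⟩ := List.mem_map.1 hy
      rw [hmul _ (List.mem_of_mem_take hg) _ hx, hfix g hg, hψx]
    intro c hc
    rw [← List.take_append_drop 5 codes, List.mem_append] at hc
    refine hc.elim (hfix c) fun hcd => ?_
    have hc := List.mem_of_mem_drop hcd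
    have hψc : ψ c ∈ codes.drop 5 := by
      have := hmem c hc
      rw [← List.take_append_drop 5 codes, List.mem_append] at this
      refine this.resolve_left fun h => ?_
      -- If `ψ c` were principal it would be fixed, so `ψ (ψ c) = ψ c` and injectivity would make c
      -- itself principal.
      have heq := hinj _ (hmem c hc) _ hc (hfix _ h)
      rw [heq] at h
      exact List.disjoint_take_drop (by decide +kernel : codes.Nodup) le_rfl h hcd
    have hmem' := codes_mul_mem c hcd
    simp only [List.mem_cons, List.mem_append] at hmem'
    refine codes_pair_injective _ hψc _ hcd ?_ ?_
    · have h := hM c hc _ me _ rfl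
      rw [fe] at h
      rw [h]
      rcases hmem'.1 with h | h | h
      · rw [h, fz]
      · exact htrans _ me fe _ h
      · exact htrans _ ma fa _ h
    · have h := hM c hc _ mf _ rfl
      rw [ff] at h
      rw [h]
      rcases hmem'.2 with h | h | h
      · rw [h, fz]
      · exact htrans _ mf ff _ h
      · exact htrans _ mb fb _ h
  -- If e and f were swapped, `ψ a` would lie in the lists for the translates of e by 0, 1 and 3,
  -- which share only z.
  · exfalso
    rw [fe] at y0e y1e y3e
    rw [ff] at y0f y1f y3f
    have h0 := (codes_mul_right_of_mul_left _ (hmem _ my0)).1 y0f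
    have h1 := (codes_mul_right_of_mul_left _ (hmem _ my1)).2.1 y1f
    have h3 := (codes_mul_right_of_mul_left _ (hmem _ my3)).2.2.2 y3f
    rw [y0e] at h0
    rw [y1e] at h1
    rw [y3e] at h3
    have h : ψ 4008241288 = 4276676736 := by
      revert h0 h1 h3
      generalize ψ 4008241288 = w
      revert w
      simp +contextual
    simpa using hinj _ ma _ mz (h.trans fz.symm)

end Rigidity
end Superextension

/-! ### Principal ultrafilters and induced automorphisms. -/

namespace Superextension

/-- The principal ultrafilter at a point, as an element of the superextension. -/
def principal {X : Type*} (x : X) : Superextension X :=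
  ⟨{A | x ∈ A}, .of_mem_or_compl_mem ⟨fun _ h => ⟨x, h⟩, fun _ h _ hAB => hAB h⟩
    (fun _ hA _ hB => ⟨x, hA, hB⟩) fun A _ => em (x ∈ A)⟩

theorem mem_principal {X : Type*} {x : X} {A : Set X} : A ∈ (principal x).1 ↔ x ∈ A :=
  Iff.rfl

theorem principal_injective {X : Type*} : Function.Injective (principal (X := X)) := by
  intro x y h
  have : {x} ∈ (principal y).1 := h ▸ mem_principal.2 (Set.mem_singleton x)
  exact (mem_principal.1 this).symm

theorem eq_principal_of_singleton_mem {X : Type*} {L : Superextension X} {x : X}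
    (h : {x} ∈ L.1) : L = principal x := by
  refine Subtype.ext (L.2.eq_of_subset (principal x).2.prop fun A hA => ?_)
  obtain ⟨y, hy, rfl⟩ := L.2.prop.2 A hA _ h
  exact hy

theorem mem_mul {S : Type*} [Semigroup S] {L M : Superextension S} {A : Set S} :
    A ∈ (L * M).1 ↔ {x | {y | x * y ∈ A} ∈ M.1} ∈ L.1 :=
  Superext.mem_familyMul L.2.prop.1 M.2.prop.1 A

theorem mem_map {X Y : Type*} [Nonempty X] {f : X → Y} {L : Superextension X} {A : Set Y} :
    A ∈ (map f L).1 ↔ f ⁻¹' A ∈ L.1 :=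
  Superext.mem_familyMap f L.2.prop.1 A

theorem ext_mem {X : Type*} {L M : Superextension X} (h : ∀ A, A ∈ L.1 ↔ A ∈ M.1) : L = M :=
  Subtype.ext (Set.ext h)

theorem principal_mul {S : Type*} [Semigroup S] (x y : S) :
    principal (x * y) = principal x * principal y :=
  ext_mem fun _ => Iff.symm <| mem_mul.trans <| by simp [mem_principal]

theorem map_principal {X Y : Type*} [Nonempty X] (f : X → Y) (x : X) :
    map f (principal x) = principal (f x) :=
  ext_mem fun _ => mem_map

theorem map_mul {S T F : Type*} [Semigroup S] [Nonempty S] [Semigroup T] [FunLike F S T]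
    [MulHomClass F S T] (f : F) (L M : Superextension S) :
    map f (L * M) = map f L * map f M := by
  refine ext_mem fun A => ?_
  simp only [mem_map, mem_mul, Set.preimage_ofPred_eq, Set.mem_preimage, _root_.map_mul]

theorem map_map {X Y Z : Type*} [Nonempty X] [Nonempty Y] (g : Y → Z) (f : X → Y)
    (L : Superextension X) : map g (map f L) = map (g ∘ f) L :=
  ext_mem fun _ => by simp only [mem_map, Set.preimage_comp]

theorem map_id {X : Type*} [Nonempty X] (L : Superextension X) : map id L = L :=
  ext_mem fun _ => mem_map

/-- The action of the automorphism group of a group on its superextension. -/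
def mapAut (G : Type*) [Group G] : MulAut G →* MulAut (Superextension G) where
  toFun φ :=
    { toFun := map φ
      invFun := map φ.symm
      left_inv := fun L => by rw [map_map, φ.symm_comp_self, map_id]
      right_inv := fun L => by rw [map_map, φ.self_comp_symm, map_id]
      map_mul' := map_mul φ }
  map_one' := MulEquiv.ext fun L => map_id L
  map_mul' φ χ := MulEquiv.ext fun L => (map_map φ χ L).symm

theorem mapAut_apply {G : Type*} [Group G] (φ : MulAut G) (L : Superextension G) :
    mapAut G φ L = map φ L :=
  rfl

theorem mapAut_injective (G : Type*) [Group G] : Function.Injective (mapAut G) := by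
  intro φ χ h
  refine MulEquiv.ext fun g => principal_injective ?_
  rw [← map_principal, ← map_principal, ← mapAut_apply, h, mapAut_apply]

theorem principal_one_mul {G : Type*} [Group G] (L : Superextension G) :
    principal 1 * L = L :=
  ext_mem fun A => by rw [mem_mul, mem_principal]; simp

theorem mul_principal_one {G : Type*} [Group G] (L : Superextension G) :
    L * principal 1 = L :=
  ext_mem fun A => by simp [mem_mul, mem_principal]

/-- The preimage of a singleton under a translation is a singleton, so a singleton in `L * M` forces
one in `M`. -/
theorem exists_eq_principal_of_mul_eq {G : Type*} [Group G] {L M : Superextension G} {g : G}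
    (h : L * M = principal g) : ∃ x, M = principal x := by
  have hg : {g} ∈ (L * M).1 := h ▸ mem_principal.2 (Set.mem_singleton g)
  obtain ⟨x, hx⟩ := L.2.prop.1.1 _ (mem_mul.1 hg)
  refine ⟨x⁻¹ * g, eq_principal_of_singleton_mem ?_⟩
  have heq : {y | x * y ∈ ({g} : Set G)} = {x⁻¹ * g} := by
    ext y
    simp [eq_inv_mul_iff_mul_eq]
  exact heq ▸ hx

/-- An automorphism of the superextension permutes the principal ultrafilters by an
automorphism of the group. -/
theorem exists_mulAut_forall_principal {G : Type*} [Group G] [Finite G]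
    (Ψ : MulAut (Superextension G)) :
    ∃ φ : MulAut G, ∀ g, Ψ (principal g) = principal (φ g) := by
  have hone : Ψ (principal 1) = principal 1 := by
    obtain ⟨L, hL⟩ := Ψ.surjective (principal 1)
    calc Ψ (principal 1) = Ψ (principal 1) * Ψ L := by rw [hL, mul_principal_one]
      _ = principal 1 := by rw [← _root_.map_mul, principal_one_mul, hL]
  have hex : ∀ g, ∃ h, Ψ (principal g) = principal h := fun g =>
    exists_eq_principal_of_mul_eq (L := Ψ (principal g⁻¹)) (g := 1) <| by
      rw [← _root_.map_mul, ← principal_mul, inv_mul_cancel, hone]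
  choose f hf using hex
  have hinj : Function.Injective f := fun g h hgh =>
    principal_injective (Ψ.injective (by rw [hf, hf, hgh]))
  have hmul : ∀ g h, f (g * h) = f g * f h := fun g h =>
    principal_injective (by rw [← hf, principal_mul, principal_mul, _root_.map_mul, hf, hf])
  exact ⟨MulEquiv.ofBijective (MulHom.mk f hmul) (Finite.injective_iff_bijective.1 hinj), hf⟩

theorem code_principal {G : Type*} (ι : Fin 5 ≃ G) (i : Fin 5) :
    code ι (principal (ι i)) = Nat.ofBits fun n : Fin 32 => (n : ℕ).testBit i := by
  simp [code, mem_principal, bitSet]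

theorem mem_take_codes : ∀ c ∈ codes.take 5,
    ∃ i : Fin 5, (Nat.ofBits fun n : Fin 32 => (n : ℕ).testBit i) = c := by
  decide +kernel

/-- An automorphism of `λ(C₅)` that fixes the principal ultrafilters is trivial. -/
theorem mulAut_eq_one_of_forall_principal {G : Type*} [CommGroup G] (ι : Fin 5 ≃ G)
    (hι : ∀ x y, ι (x + y) = ι x * ι y) (Ψ : MulAut (Superextension G))
    (hΨ : ∀ g, Ψ (principal g) = principal g) : Ψ = 1 := by
  have : Nonempty (Superextension G) := ⟨principal 1⟩
  -- `Ψ` is transported to numbers through `Function.invFun`; its arbitrary values off `codes` play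
  -- no role.
  have hinv := Function.leftInverse_invFun (code_injective ι)
  have hψ : ∀ L, code ι (Ψ (Function.invFun (code ι) (code ι L))) = code ι (Ψ L) := fun L => by
    rw [hinv]
  have key := codes_rigid (fun c => code ι (Ψ (Function.invFun (code ι) c)))
    (fun _ _ => code_mem_codes ι _) ?_ ?_ ?_
  · refine MulEquiv.ext fun L => code_injective ι ?_
    rw [MulAut.one_apply, ← hψ]
    exact key _ (code_mem_codes ι L)
  · intro c hc d hd
    obtain ⟨L, rfl⟩ := exists_code_eq ι hc
    obtain ⟨M, rfl⟩ := exists_code_eq ι hd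
    simp only [← code_mul ι hι, hψ, _root_.map_mul]
  · intro c hc d hd
    obtain ⟨L, rfl⟩ := exists_code_eq ι hc
    obtain ⟨M, rfl⟩ := exists_code_eq ι hd
    simp only [hψ]
    exact fun h => congrArg _ (Ψ.injective (code_injective ι h))
  · intro c hc
    obtain ⟨i, rfl⟩ := mem_take_codes c hc
    rw [← code_principal, hψ, hΨ]

theorem mapAut_surjective {G : Type*} [CommGroup G] (ι : Fin 5 ≃ G)
    (hι : ∀ x y, ι (x + y) = ι x * ι y) : Function.Surjective (mapAut G) := by
  intro Ψ
  have := Finite.of_equiv _ ι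
  obtain ⟨φ, hφ⟩ := exists_mulAut_forall_principal Ψ
  refine ⟨φ, (inv_mul_eq_one.1 (mulAut_eq_one_of_forall_principal ι hι _ fun g => ?_))⟩
  rw [MulAut.mul_apply, hφ, ← map_principal, ← mapAut_apply, MulAut.inv_apply_self]

end Superextension

/-! ### The group C₅ and its automorphisms. -/

theorem card_rootGroup (n : ℕ) [NeZero n] : Nat.card (RootGroup n) = n := by
  exact Complex.card_rootsOfUnity n

theorem exists_equiv_rootGroup_five :
    ∃ ι : Fin 5 ≃ RootGroup 5, ∀ x y, ι (x + y) = ι x * ι y := by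
  let e : Multiplicative (ZMod 5) ≃* RootGroup 5 := mulEquivOfCyclicCardEq <| by
    rw [card_rootGroup, Nat.card_congr Multiplicative.toAdd, Nat.card_zmod]
  exact ⟨Multiplicative.ofAdd.trans e.toEquiv, fun x y => e.map_mul (.ofAdd x) (.ofAdd y)⟩

theorem nonempty_mulAut_rootGroup_five : Nonempty (MulAut (RootGroup 5) ≃* RootGroup 4) := by
  have : Fact (Nat.Prime 5) := ⟨Nat.prime_five⟩
  have h5 := card_rootGroup 5
  have e := IsCyclic.mulAutMulEquiv (RootGroup 5)
  rw [h5] at e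
  refine ⟨e.trans (mulEquivOfCyclicCardEq ?_)⟩
  rw [card_rootGroup, Nat.card_eq_fintype_card, ZMod.card_units]

theorem mainTheorem5 :
    Nat.card (Superextension (RootGroup 5)) = 81 ∧
    (∃ e : MulAut (RootGroup 5) ≃* MulAut (Superextension (RootGroup 5)),
      ∀ (φ : MulAut (RootGroup 5)) (L : Superextension (RootGroup 5)),
        e φ L = Superextension.map φ L) ∧
    Nonempty (MulAut (RootGroup 5) ≃* RootGroup 4) := by
  obtain ⟨ι, hι⟩ := exists_equiv_rootGroup_five
  refine ⟨Superextension.card_eq_of_equiv_fin_five ι, ⟨MulEquiv.ofBijective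
    (Superextension.mapAut (RootGroup 5)) ⟨Superextension.mapAut_injective _,
      Superextension.mapAut_surjective ι hι⟩, fun _ _ => rfl⟩, nonempty_mulAut_rootGroup_five⟩
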